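/- For a complex polynomial $f(x)=a\prod_{n}(x-\gamma_n)$ let $\mu(f)=|a|\prod_n\max\{1,|\gamma_n|\}$ be its Mahler measure ($\mu(0)=0$), extended to Laurent polynomials by $\mu(x^{-n}f)=\mu(f)$, and let $\rho(f)=\mu\bigl(f(x+1/x)\bigr)$ be the reciprocal Mahler measure of $f\in\mathbb{C}[x]$. For $J\ge 0$ let $$\mathcal{U}_J(\rho)=\Bigl\{(a_1,\dots,a_{J+1})\in\mathbb{R}^{J+1} : \rho\Bigl(\sum_{n=1}^{J+1}a_n x^{J+1-n}\Bigr)\le 1\Bigr\},$$ and let $\lambda_{J+1}$ be Lebesgue measure on $\mathbb{R}^{J+1}$. A polynomial $f$ of degree $M$ is called reciprocal if $f(x)=x^M f(1/x)$ (the zero polynomial is counted as reciprocal). For $T\in\mathbb{R}$ let $\mathcal{M}_N(T)$ be the set of reciprocal polynomials $f\in\mathbb{Z}[x]$ with $\deg f\le N$ and $\mu(f)\le T$. Let $N$ be a positive integer. Then every set $\mathcal{M}_N(T)$ is finite, every volume $\lambda_{J+1}(\mathcal{U}_J(\rho))$, $J\ge 0$, is finite, and, as $T\to\infty$, $$\#\mathcal{M}_N(T)=\begin{cases}\lambda_{J+1}(\mathcal{U}_J(\rho))\,T^{J+1}+O(T^J)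 & \text{if } N=2J,\\ 2\,\lambda_{J+1}(\mathcal{U}_J(\rho))\,T^{J+1}+O(T^J) & \text{if } N=2J+1,\end{cases}$$ where the constant implicit in the $O$-notation depends on $J$. -/

import Mathlib

open Polynomial Filter Asymptotics MeasureTheory

noncomputable section

namespace ReciprocalMahler

/-- Mahler's measure of a complex Laurent polynomial `g`: the Mahler measure of a polynomial `p`
with `p = x ^ n * g`, that is, the multiplicative extension with value `1` at `x⁻¹`.
It does not depend on the choice of `n` and `p`, see `laurentMahlerMeasure_eq`. -/
def laurentMahlerMeasure (g : LaurentPolynomial ℂ) : ℝ :=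
  (g.exists_T_pow.choose_spec.choose).mahlerMeasure

theorem laurentMahlerMeasure_eq {g : LaurentPolynomial ℂ} {n : ℕ} {p : ℂ[X]}
    (h : p.toLaurent = g * LaurentPolynomial.T n) :
    laurentMahlerMeasure g = p.mahlerMeasure := by
  have h' := g.exists_T_pow.choose_spec.choose_spec
  unfold laurentMahlerMeasure
  generalize g.exists_T_pow.choose_spec.choose = q at *
  generalize g.exists_T_pow.choose = m at *
  have hX : ∀ k : ℕ, ((X : ℂ[X]) ^ k).mahlerMeasure = 1 := by
    intro k
    simp [mahlerMeasure, logMahlerMeasure_monomial, ← monomial_one_right_eq_X_pow]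
  have key : q * X ^ n = p * X ^ m := by
    apply toLaurent_injective
    rw [map_mul, map_mul, toLaurent_X_pow, toLaurent_X_pow, h, h', mul_right_comm]
  have := congrArg mahlerMeasure key
  simpa [mahlerMeasure_mul, hX] using this

/-- The reciprocal Mahler measure: `ρ(f) = μ(f(x + 1/x))`. -/
def rho (f : ℂ[X]) : ℝ :=
  laurentMahlerMeasure (aeval (LaurentPolynomial.T 1 + LaurentPolynomial.T (-1)) f)

/-- The polynomial `∑ i, a i * x ^ (N - i)` with coefficient vector `a`, leading term first. -/
def ofCoeffs {N : ℕ} (a : Fin (N + 1) → ℂ) : ℂ[X] :=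
  ∑ i : Fin (N + 1), C (a i) * X ^ (N - (i : ℕ))

/-- The degree `N` real unit star body of `Φ`. -/
def realUnitStarBody (Φ : ℂ[X] → ℝ) (N : ℕ) : Set (Fin (N + 1) → ℝ) :=
  {a | Φ (ofCoeffs fun i => (a i : ℂ)) ≤ 1}

/-- `f` is reciprocal if `f(x) = x ^ M * f(1/x)`, where `M` is the degree of `f`. -/
def IsReciprocal (f : ℤ[X]) : Prop := f.reverse = f

/-- The reciprocal integer polynomials of degree at most `N` and Mahler measure at most `t`. -/
def recipPolys (N : ℕ) (t : ℝ) : Set ℤ[X] :=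
  {f | IsReciprocal f ∧ f.natDegree ≤ N ∧ (f.map (Int.castRingHom ℂ)).mahlerMeasure ≤ t}

end ReciprocalMahler

end

/-! A reciprocal polynomial of degree `2 m` is `xᵐ f(x + 1/x)` for a unique `f` of degree `m`, and
its Mahler measure is `ρ(f)`; one of odd degree is `x + 1` times a reciprocal polynomial of even
degree and the same Mahler measure. Up to the zero polynomial, which is counted twice, `ℳ_N(T)`
therefore consists of the integer points of two dilated star bodies `T 𝒰(ρ)`.

Since the star body is bounded, the number of these points is the volume up to the number of unit
cubes that meet the boundary, where `ρ = 1`. By multiplicativity of `ρ` and the factorization of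
real polynomials, this level set consists of products of linear and quadratic polynomials with
`ρ = 1`. Those are parametrized, up to constants, by means of `ρ(α x - (1 + α²)) = 1` for
`|α| ≤ 1`, because `x (α (x + 1/x) - (1 + α²)) = (α x - 1) (x - α)`. Hence the level set is a finite
union of `C¹` images of compact sets of dimension `J`, and it meets only `O(T ^ J)` of the cubes.
-/

noncomputable section

namespace ReciprocalMahler

open scoped NNReal

section Cover

variable {E F : Type*}

/-- A compact set that is covered by `O(ε⁻ᵏ)` balls of radius `ε ≤ 1`, that is, a compact set whose
`k`-dimensional upper Minkowski content is finite. The centres are taken in `A`, so that only the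
restriction of a map to `A` matters for the image of a cover. -/
def HasCover [PseudoMetricSpace E] (k : ℕ) (A : Set E) : Prop :=
  IsCompact A ∧ ∃ C : ℝ≥0, ∀ ε : ℝ≥0, 0 < ε → ε ≤ 1 →
    ∃ S : Finset E, ↑S ⊆ A ∧ Metric.IsCover ε A S ∧ S.card * ε ^ k ≤ C

theorem HasCover.of_finite [PseudoMetricSpace E] {A : Set E} (hA : A.Finite) : HasCover 0 A := by
  refine ⟨hA.isCompact, hA.toFinset.card, fun ε _ _ => ⟨hA.toFinset, ?_, ?_, ?_⟩⟩ <;> simp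

theorem hasCover_Icc : HasCover 1 (Set.Icc (-1 : ℝ) 1) := by
  refine ⟨isCompact_Icc, 3, fun ε hε hε1 => ⟨(Finset.range (⌊2 / ε⌋₊ + 1)).image
    fun i : ℕ => -1 + i * (ε : ℝ), ?_, fun x hx => ?_, ?_⟩⟩
  · intro x hx
    obtain ⟨i, hi, rfl⟩ := Finset.mem_image.1 (Finset.mem_coe.1 hx)
    have hi : i * ε ≤ 2 := by
      rw [← le_div_iff₀ hε, ← Nat.le_floor_iff zero_le]
      exact Nat.lt_succ_iff.1 (Finset.mem_range.1 hi)
    have hi' : (i * ε : ℝ) ≤ 2 := mod_cast hi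
    exact ⟨by linarith [show (0 : ℝ) ≤ i * ε by positivity], by linarith [hi']⟩
  · have hε' : (0 : ℝ) < ε := hε
    have h0 : 0 ≤ (x + 1) / ε := div_nonneg (by linarith [hx.1]) hε'.le
    have hfloor := Nat.floor_le h0
    have hfloor' := Nat.lt_floor_add_one ((x + 1) / ε)
    rw [le_div_iff₀ hε'] at hfloor
    rw [div_lt_iff₀ hε'] at hfloor'
    refine ⟨-1 + ⌊(x + 1) / ε⌋₊ * (ε : ℝ), Finset.mem_coe.2 (Finset.mem_image_of_mem _ ?_), ?_⟩
    · rw [Finset.mem_range, Nat.lt_succ_iff, Nat.le_floor_iff zero_le, ← NNReal.coe_le_coe]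
      refine (Nat.floor_le h0).trans ?_
      push_cast
      gcongr
      linarith [hx.2]
    · change edist _ _ ≤ (ε : ENNReal)
      rw [edist_nndist, ENNReal.coe_le_coe, ← NNReal.coe_le_coe, coe_nndist, Real.dist_eq, abs_le]
      constructor <;> linarith
  · have hcard : (((Finset.range (⌊2 / ε⌋₊ + 1)).image fun i : ℕ => -1 + i * (ε : ℝ)).card : ℝ≥0) ≤
        2 / ε + 1 := by
      refine (Nat.cast_le.2 Finset.card_image_le).trans ?_
      rw [Finset.card_range, Nat.cast_succ]
      gcongr
      exact Nat.floor_le zero_le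
    calc _ ≤ (2 / ε + 1) * ε ^ 1 := by gcongr
      _ = 2 + ε := by field_simp
      _ ≤ 2 + 1 := by gcongr
      _ = 3 := by norm_num

theorem HasCover.union [PseudoMetricSpace E] {k : ℕ} {A B : Set E} (hA : HasCover k A)
    (hB : HasCover k B) : HasCover k (A ∪ B) := by
  classical
  obtain ⟨hA, C, hC⟩ := hA
  obtain ⟨hB, D, hD⟩ := hB
  refine ⟨hA.union hB, C + D, fun ε hε hε1 => ?_⟩
  obtain ⟨S, hSA, hS, hSC⟩ := hC ε hε hε1
  obtain ⟨T, hTB, hT, hTD⟩ := hD ε hε hε1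
  refine ⟨S ∪ T, ?_, ?_, ?_⟩
  · rw [Finset.coe_union]
    exact Set.union_subset_union hSA hTB
  · rw [Finset.coe_union]
    rintro x (hx | hx)
    · exact hS.mono Set.subset_union_left hx
    · exact hT.mono Set.subset_union_right hx
  · calc ((S ∪ T).card * ε ^ k : ℝ≥0) ≤ (S.card + T.card) * ε ^ k := by
          gcongr
          exact_mod_cast Finset.card_union_le S T
      _ = S.card * ε ^ k + T.card * ε ^ k := add_mul _ _ _
      _ ≤ C + D := add_le_add hSC hTD

theorem HasCover.prod [PseudoMetricSpace E] [PseudoMetricSpace F] {j k : ℕ} {A : Set E} {B : Set F}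
    (hA : HasCover j A) (hB : HasCover k B) : HasCover (j + k) (A ×ˢ B) := by
  obtain ⟨hA, C, hC⟩ := hA
  obtain ⟨hB, D, hD⟩ := hB
  refine ⟨hA.prod hB, C * D, fun ε hε hε1 => ?_⟩
  obtain ⟨S, hSA, hS, hSC⟩ := hC ε hε hε1
  obtain ⟨T, hTB, hT, hTD⟩ := hD ε hε hε1
  refine ⟨S ×ˢ T, ?_, ?_, ?_⟩
  · rw [Finset.coe_product]
    exact Set.prod_mono hSA hTB
  · rintro ⟨a, b⟩ ⟨ha, hb⟩
    obtain ⟨p, hp, hap⟩ := hS ha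
    obtain ⟨q, hq, hbq⟩ := hT hb
    exact ⟨(p, q), Finset.mk_mem_product hp hq, show edist (a, b) (p, q) ≤ ε from max_le hap hbq⟩
  · calc ((S ×ˢ T).card * ε ^ (j + k) : ℝ≥0) = (S.card * ε ^ j) * (T.card * ε ^ k) := by
          rw [Finset.card_product]
          push_cast
          ring
      _ ≤ C * D := mul_le_mul' hSC hTD

theorem HasCover.image_of_lipschitzOnWith [PseudoMetricSpace E] [PseudoMetricSpace F] {k : ℕ}
    {A : Set E} (hA : HasCover k A) {K : ℝ≥0} {f : E → F} (hf : LipschitzOnWith K f A) :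
    HasCover k (f '' A) := by
  classical
  obtain ⟨hA, C, hC⟩ := hA
  have hK : 0 < max K 1 := by positivity
  refine ⟨hA.image_of_continuousOn hf.continuousOn, C * (max K 1) ^ k, fun ε hε hε1 => ?_⟩
  obtain ⟨S, hSA, hS, hSC⟩ := hC (ε / max K 1) (by positivity)
    ((div_le_self zero_le (le_max_right K 1)).trans hε1)
  refine ⟨S.image f, ?_, ?_, ?_⟩
  · rw [Finset.coe_image]
    exact Set.image_mono hSA
  · rintro _ ⟨x, hx, rfl⟩
    obtain ⟨p, hp, hxp⟩ := hS hx
    refine ⟨f p, Finset.mem_coe.2 (Finset.mem_image_of_mem f hp), (hf hx (hSA hp)).trans ?_⟩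
    calc (K : ENNReal) * edist x p ≤ (max K 1 : ℝ≥0) * ((ε / max K 1 : ℝ≥0) : ENNReal) := by
          gcongr
          exacts [le_max_left K 1, hxp]
      _ = ε := by rw [← ENNReal.coe_mul, mul_div_cancel₀ _ hK.ne']
  · calc ((S.image f).card * ε ^ k : ℝ≥0) ≤ S.card * ε ^ k := by
          gcongr
          exact Finset.card_image_le
      _ = S.card * (ε / max K 1) ^ k * (max K 1) ^ k := by
          rw [div_pow, mul_assoc, div_mul_cancel₀ _ (pow_ne_zero k hK.ne')]
      _ ≤ C * (max K 1) ^ k := by gcongr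

theorem HasCover.image [NormedAddCommGroup E] [NormedSpace ℝ E] [NormedAddCommGroup F]
    [NormedSpace ℝ F] {k : ℕ} {A : Set E} (hA : HasCover k A) {f : E → F} (hf : ContDiff ℝ 1 f) :
    HasCover k (f '' A) :=
  have ⟨_, hK⟩ := hf.locallyLipschitz.locallyLipschitzOn.exists_lipschitzOnWith_of_compact hA.1
  hA.image_of_lipschitzOnWith hK

end Cover

section LatticePoints

variable {ι : Type*} {t : ℝ}

/-- The lower corner of the cube of side `t⁻¹` of the grid `t⁻¹ ℤ ^ ι` with index `z`. -/
def corner (t : ℝ) (z : ι → ℤ) : ι → ℝ := fun i => z i / t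

/-- The half-open cube of side `t⁻¹` with lower corner `corner t z`; these cubes partition the
space, and every one contains exactly one lattice point. -/
def cell (t : ℝ) (z : ι → ℤ) : Set (ι → ℝ) :=
  Set.pi Set.univ fun i => Set.Ico (z i / t : ℝ) ((z i + 1) / t)

/-- The index of the cell that contains the point `x`. -/
def cellIndex (t : ℝ) (x : ι → ℝ) : ι → ℤ := fun i => ⌊t * x i⌋

theorem mem_cell_iff (ht : 0 < t) {z : ι → ℤ} {x : ι → ℝ} : x ∈ cell t z ↔ cellIndex t x = z := by
  simp only [cell, cellIndex, Set.mem_univ_pi, Set.mem_Ico, funext_iff, Int.floor_eq_iff,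
    div_le_iff₀ ht, lt_div_iff₀ ht, mul_comm t]

theorem cellIndex_corner (ht : 0 < t) (z : ι → ℤ) : cellIndex t (corner t z) = z := by
  funext i
  rw [cellIndex, corner, mul_div_cancel₀ _ ht.ne', Int.floor_intCast]

theorem isPreconnected_cell (t : ℝ) (z : ι → ℤ) : IsPreconnected (cell t z) :=
  (convex_pi fun _ _ => convex_Ico _ _).isPreconnected

theorem pairwise_disjoint_cell (ht : 0 < t) :
    Pairwise (Function.onFun Disjoint (cell (ι := ι) t)) := by
  refine fun z w hzw => Set.disjoint_left.2 fun x hx hx' => hzw ?_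
  rw [← (mem_cell_iff ht).1 hx, (mem_cell_iff ht).1 hx']

theorem nonempty_inter_frontier {E : Type*} [TopologicalSpace E] {A Q : Set E}
    (hQ : IsPreconnected Q) (hA : (Q ∩ A).Nonempty) (hA' : (Q ∩ Aᶜ).Nonempty) :
    (Q ∩ frontier A).Nonempty := by
  rw [frontier_eq_closure_inter_closure]
  refine isPreconnected_closed_iff.1 hQ _ _ isClosed_closure isClosed_closure (fun x _ => ?_)
    (hA.mono (Set.inter_subset_inter_right Q subset_closure))
    (hA'.mono (Set.inter_subset_inter_right Q subset_closure))
  exact (em (x ∈ A)).imp (fun h => subset_closure h) fun h => subset_closure h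

theorem cellIndex_mem_image_frontier (ht : 0 < t) {A : Set (ι → ℝ)} {x y : ι → ℝ}
    (hxy : cellIndex t x = cellIndex t y) (hx : x ∈ A) (hy : y ∉ A) :
    cellIndex t x ∈ cellIndex t '' frontier A := by
  obtain ⟨w, hw, hwA⟩ := nonempty_inter_frontier (isPreconnected_cell t (cellIndex t x))
    ⟨x, (mem_cell_iff ht).2 rfl, hx⟩ ⟨y, (mem_cell_iff ht).2 hxy.symm, hy⟩
  exact ⟨w, hwA, (mem_cell_iff ht).1 hw⟩

theorem abs_floor_sub_floor_le {a b : ℝ} (h : |a - b| ≤ 1) : |⌊a⌋ - ⌊b⌋| ≤ 1 := by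
  obtain ⟨h1, h2⟩ := abs_le.1 h
  have hab : ⌊a⌋ ≤ ⌊b⌋ + 1 := Int.floor_add_one b ▸ Int.floor_mono (by linarith)
  have hba : ⌊b⌋ ≤ ⌊a⌋ + 1 := Int.floor_add_one a ▸ Int.floor_mono (by linarith)
  rw [abs_le]
  omega

theorem finite_setOf_corner_mem [Finite ι] {A : Set (ι → ℝ)} (hA : Bornology.IsBounded A)
    (ht : 0 < t) :
    {z : ι → ℤ | corner t z ∈ A}.Finite := by
  classical
  cases nonempty_fintype ι
  obtain ⟨R, hR⟩ := hA.subset_closedBall 0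
  refine (Set.finite_Icc (fun _ => -⌈R * t⌉) (fun _ => ⌈R * t⌉)).subset fun z hz => ?_
  have hz : ∀ i, |z i| ≤ ⌈R * t⌉ := fun i => by
    have hi := (norm_le_pi_norm _ i).trans (mem_closedBall_zero_iff.1 (hR hz))
    rw [corner, Real.norm_eq_abs, abs_div, abs_of_pos ht, div_le_iff₀ ht] at hi
    exact_mod_cast hi.trans (Int.le_ceil _)
  exact ⟨fun i => (abs_le.1 (hz i)).1, fun i => (abs_le.1 (hz i)).2⟩

variable [Fintype ι]

theorem volume_real_biUnion_cell (ht : 0 < t) (S : Finset (ι → ℤ)) :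
    volume.real (⋃ z ∈ S, cell t z) = S.card / t ^ Fintype.card ι := by
  have hside : ∀ m : ℤ, ((m + 1) / t - m / t : ℝ) = t⁻¹ := fun m => by ring
  have hcell : ∀ z : ι → ℤ, volume (cell t z) = ENNReal.ofReal t⁻¹ ^ Fintype.card ι := fun z => by
    simp only [cell, Real.volume_pi_Ico, hside, Finset.prod_const, Finset.card_univ]
  rw [measureReal_biUnion_finset (fun z _ w _ hzw => pairwise_disjoint_cell ht hzw)
    (fun z _ => MeasurableSet.univ_pi fun _ => measurableSet_Ico)
    (fun z _ => by rw [hcell]; finiteness)]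
  simp only [measureReal_def, hcell, ENNReal.toReal_pow, ENNReal.toReal_ofReal (inv_pos.2 ht).le,
    Finset.sum_const, nsmul_eq_mul, inv_pow, div_eq_mul_inv]

theorem volume_biUnion_cell_ne_top (S : Finset (ι → ℤ)) :
    volume (⋃ z ∈ S, cell t z) ≠ ⊤ := by
  refine (measure_biUnion_lt_top S.finite_toSet fun z _ => ?_).ne
  rw [cell, Real.volume_pi_Ico]
  exact ENNReal.prod_lt_top fun i _ => ENNReal.ofReal_lt_top

theorem abs_cellIndex_sub_cellIndex_le (ht : 0 < t) {x y : ι → ℝ} (h : dist x y ≤ t⁻¹) (i : ι) :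
    |cellIndex t x i - cellIndex t y i| ≤ 1 := by
  refine abs_floor_sub_floor_le ?_
  rw [← mul_sub, abs_mul, abs_of_pos ht, ← Real.dist_eq, mul_comm, ← le_div_iff₀ ht, one_div]
  exact (dist_le_pi_dist x y i).trans h

theorem HasCover.exists_cellIndex_image_subset {k : ℕ} {K : Set (ι → ℝ)} (hK : HasCover k K) :
    ∃ C : ℝ, ∀ t : ℝ, 1 ≤ t → ∃ B : Finset (ι → ℤ),
      (B.card : ℝ) ≤ C * t ^ k ∧ cellIndex t '' K ⊆ B := by
  classical
  obtain ⟨-, C, hC⟩ := hK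
  refine ⟨3 ^ Fintype.card ι * C, fun t ht => ?_⟩
  have ht0 : 0 < t := by linarith
  lift t to ℝ≥0 using ht0.le
  norm_cast at ht ht0
  obtain ⟨S, -, hS, hSC⟩ := hC t⁻¹ (inv_pos.2 ht0) (inv_le_one_of_one_le₀ ht)
  let nbhd (p : ι → ℝ) : Finset (ι → ℤ) :=
    Fintype.piFinset fun i => Finset.Icc (cellIndex t p i - 1) (cellIndex t p i + 1)
  have hnbhd : ∀ p, (nbhd p).card = 3 ^ Fintype.card ι := fun p => by
    simp [nbhd, Fintype.card_piFinset, add_assoc]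
  refine ⟨S.biUnion nbhd, ?_, ?_⟩
  · suffices h : (S.biUnion nbhd).card ≤ 3 ^ Fintype.card ι * C * t ^ k from mod_cast h
    calc ((S.biUnion nbhd).card : ℝ≥0) ≤ (S.card * 3 ^ Fintype.card ι : ℕ) :=
          Nat.cast_le.2 (Finset.card_biUnion_le_card_mul _ _ _ fun p _ => (hnbhd p).le)
      _ = 3 ^ Fintype.card ι * (S.card * t⁻¹ ^ k) * t ^ k := by
          rw [inv_pow, mul_assoc, inv_mul_cancel_right₀ (pow_ne_zero k ht0.ne'), mul_comm]
          norm_cast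
      _ ≤ 3 ^ Fintype.card ι * C * t ^ k := by gcongr
  · rintro _ ⟨x, hx, rfl⟩
    obtain ⟨p, hp, hxp⟩ := hS hx
    have hxp : nndist x p ≤ t⁻¹ := ENNReal.coe_le_coe.1 ((edist_nndist x p).symm.trans_le hxp)
    refine Finset.mem_coe.2 (Finset.mem_biUnion.2 ⟨p, hp, Fintype.mem_piFinset.2 fun i => ?_⟩)
    have hi := abs_le.1 (abs_cellIndex_sub_cellIndex_le (NNReal.coe_pos.2 ht0) (mod_cast hxp) i)
    rw [Finset.mem_Icc]
    omega

theorem HasCover.isBigO_ncard_corner_mem {k : ℕ} {A K : Set (ι → ℝ)} (hK : HasCover k K)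
    (hA : Bornology.IsBounded A) (hAK : frontier A ⊆ K) :
    (fun t : ℝ => ({z : ι → ℤ | corner t z ∈ A}.ncard : ℝ) - volume.real A * t ^ Fintype.card ι)
      =O[atTop] fun t => t ^ k := by
  classical
  obtain ⟨C, hC⟩ := hK.exists_cellIndex_image_subset
  refine IsBigO.of_bound C ((eventually_ge_atTop 1).mono fun t ht => ?_)
  have ht0 : 0 < t := by linarith
  obtain ⟨B, hBC, hKB⟩ := hC t ht
  have hB : cellIndex t '' frontier A ⊆ B := (Set.image_mono hAK).trans hKB
  have hfin := finite_setOf_corner_mem hA ht0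
  let L : Finset (ι → ℤ) := hfin.toFinset
  have hupper : A ⊆ ⋃ z ∈ L ∪ B, cell t z := fun x hx => by
    refine Set.mem_biUnion (x := cellIndex t x) ?_ ((mem_cell_iff ht0).2 rfl)
    rw [Finset.mem_coe, Finset.mem_union, or_iff_not_imp_left, hfin.mem_toFinset]
    exact fun h => hB (cellIndex_mem_image_frontier ht0 (cellIndex_corner ht0 _).symm hx h)
  have hlower : ⋃ z ∈ L \ B, cell t z ⊆ A := by
    refine Set.iUnion₂_subset fun z hz x hx => ?_
    rw [Finset.mem_sdiff, hfin.mem_toFinset] at hz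
    by_contra hxA
    refine hz.2 (hB ?_)
    rw [← cellIndex_corner ht0 z]
    exact cellIndex_mem_image_frontier ht0
      ((cellIndex_corner ht0 z).trans ((mem_cell_iff ht0).1 hx).symm) hz.1 hxA
  have hle := measureReal_mono hupper (volume_biUnion_cell_ne_top _)
  have hge := measureReal_mono (μ := volume) hlower hA.measure_lt_top.ne
  rw [volume_real_biUnion_cell ht0] at hle hge
  rw [le_div_iff₀ (by positivity)] at hle
  rw [div_le_iff₀ (by positivity)] at hge
  have hcup : ((L ∪ B).card : ℝ) ≤ L.card + B.card := mod_cast Finset.card_union_le L B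
  have hsdiff : (L.card : ℝ) ≤ (L \ B).card + B.card := mod_cast Finset.card_le_card_sdiff_add_card
  rw [Set.ncard_eq_toFinset_card _ hfin, Real.norm_eq_abs, Real.norm_of_nonneg (by positivity),
    abs_le]
  constructor <;> linarith

end LatticePoints

section Homogeneous

variable {E : Type*} [NormedAddCommGroup E] [NormedSpace ℝ E] {φ : E → ℝ}

theorem isCompact_sublevel_one (hpos : ∀ x, x ≠ 0 → 0 < φ x)
    (hsmul : ∀ (r : ℝ) x, φ (r • x) = |r| * φ x) (hφ : IsCompact {x | φ x = 1}) :
    IsCompact {x | φ x ≤ 1} := by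
  suffices h : {x | φ x ≤ 1} = insert 0 ((fun p : ℝ × E => p.1 • p.2) ''
      (Set.Icc 0 1 ×ˢ {x | φ x = 1})) by
    rw [h]
    exact ((isCompact_Icc.prod hφ).image (by fun_prop)).insert 0
  ext x
  constructor
  · intro hx
    rcases eq_or_ne x 0 with rfl | hx0
    · exact Set.mem_insert _ _
    · have hφx := hpos x hx0
      refine Or.inr ⟨(φ x, (φ x)⁻¹ • x), ⟨⟨hφx.le, hx⟩, ?_⟩, smul_inv_smul₀ hφx.ne' x⟩
      change φ ((φ x)⁻¹ • x) = 1
      rw [hsmul, abs_of_pos (inv_pos.2 hφx), inv_mul_cancel₀ hφx.ne']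
  · rintro (rfl | ⟨⟨r, y⟩, ⟨hr, hy : φ y = 1⟩, rfl⟩)
    · have h0 : φ 0 = 0 := by simpa using hsmul 0 0
      exact h0.trans_le zero_le_one
    · change φ (r • y) ≤ 1
      rw [hsmul, abs_of_nonneg hr.1, hy, mul_one]
      exact hr.2

theorem isClosed_superlevel_one (hpos : ∀ x, x ≠ 0 → 0 < φ x)
    (hsmul : ∀ (r : ℝ) x, φ (r • x) = |r| * φ x) (hφ : IsCompact {x | φ x = 1}) :
    IsClosed {x | 1 ≤ φ x} := by
  suffices h : {x | 1 ≤ φ x} =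
      Prod.snd '' {p : Set.Icc (0 : ℝ) 1 × E | (p.1 : ℝ) • p.2 ∈ {x | φ x = 1}} by
    rw [h]
    exact isClosedMap_snd_of_compactSpace _ (hφ.isClosed.preimage (by fun_prop))
  ext x
  constructor
  · intro hx
    have hφx : 0 < φ x := zero_lt_one.trans_le hx
    refine ⟨(⟨(φ x)⁻¹, (inv_pos.2 hφx).le, inv_le_one_of_one_le₀ hx⟩, x), ?_, rfl⟩
    change φ ((φ x)⁻¹ • x) = 1
    rw [hsmul, abs_of_pos (inv_pos.2 hφx), inv_mul_cancel₀ hφx.ne']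
  · rintro ⟨⟨⟨r, hr⟩, y⟩, hy : φ (r • y) = 1, rfl⟩
    change 1 ≤ φ y
    rw [hsmul, abs_of_nonneg hr.1] at hy
    rcases eq_or_ne y 0 with rfl | hy0
    · have h0 : φ 0 = 0 := by simpa using hsmul 0 0
      simp [h0] at hy
    · exact hy.symm.trans_le (mul_le_of_le_one_left (hpos y hy0).le hr.2)

theorem frontier_sublevel_one_subset (hpos : ∀ x, x ≠ 0 → 0 < φ x)
    (hsmul : ∀ (r : ℝ) x, φ (r • x) = |r| * φ x) (hφ : IsCompact {x | φ x = 1}) :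
    frontier {x | φ x ≤ 1} ⊆ {x | φ x = 1} := by
  have hge : closure {x | φ x ≤ 1}ᶜ ⊆ {x | 1 ≤ φ x} :=
    closure_minimal (fun x (hx : ¬φ x ≤ 1) => (not_le.1 hx).le)
      (isClosed_superlevel_one hpos hsmul hφ)
  rw [frontier_eq_closure_inter_closure,
    (isCompact_sublevel_one hpos hsmul hφ).isClosed.closure_eq]
  exact fun x hx => le_antisymm hx.1 (hge hx.2)

end Homogeneous

section RecipLift

open LaurentPolynomial (T)

variable {R S : Type*} [CommRing R] [CommRing S]

/-- The polynomial `xᵐ f(x + 1/x)` for `f` of degree at most `m`; coefficients of `f` beyond the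
`m`-th are ignored. -/
def recipLift (m : ℕ) (f : R[X]) : R[X] :=
  ∑ k ∈ Finset.range (m + 1), C (f.coeff k) * (X ^ 2 + 1) ^ k * X ^ (m - k)

theorem toLaurent_recipLift {m : ℕ} {f : R[X]} (hf : f.natDegree ≤ m) :
    toLaurent (recipLift m f) = aeval (T 1 + T (-1)) f * T m := by
  have hX : toLaurent ((X : R[X]) ^ 2 + 1) = (T 1 + T (-1)) * T 1 := by
    rw [add_mul, ← LaurentPolynomial.T_add, ← LaurentPolynomial.T_add, map_add, toLaurent_X_pow,
      toLaurent_one]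
    norm_num
  rw [recipLift, map_sum, aeval_eq_sum_range' (Nat.lt_succ_of_le hf), Finset.sum_mul]
  refine Finset.sum_congr rfl fun k hk => ?_
  have hk : k ≤ m := Finset.mem_range_succ_iff.1 hk
  have hT : (T 1 : LaurentPolynomial R) ^ k * T ((m - k : ℕ) : ℤ) = T m := by
    rw [LaurentPolynomial.T_pow, ← LaurentPolynomial.T_add, Nat.cast_sub hk]
    ring_nf
  rw [map_mul, map_mul, map_pow, hX, toLaurent_X_pow, toLaurent_C, mul_pow, Algebra.smul_def,
    LaurentPolynomial.algebraMap_apply, mul_assoc, mul_assoc, mul_assoc, hT]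
  rfl

theorem recipLift_zero (m : ℕ) : recipLift m (0 : R[X]) = 0 := by
  simp [recipLift]

theorem recipLift_one_C_mul_X_add_C (a b : R) :
    recipLift 1 (C a * X + C b) = C a * (X ^ 2 + 1) + C b * X := by
  simp [recipLift, Finset.sum_range_succ, add_comm]

theorem recipLift_map (φ : R →+* S) (m : ℕ) (f : R[X]) :
    recipLift m (f.map φ) = (recipLift m f).map φ := by
  simp [recipLift, Polynomial.map_sum]

theorem recipLift_succ (m : ℕ) (f : R[X]) :
    recipLift (m + 1) f = C (f.coeff (m + 1)) * (X ^ 2 + 1) ^ (m + 1) + X * recipLift m f := by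
  rw [recipLift, Finset.sum_range_succ, add_comm, recipLift, Finset.mul_sum, Nat.sub_self, pow_zero,
    mul_one]
  congr 1
  refine Finset.sum_congr rfl fun k hk => ?_
  rw [Nat.succ_sub (Finset.mem_range_succ_iff.1 hk), pow_succ' X (m - k)]
  ring

theorem coeff_zero_X_sq_add_one_pow (k : ℕ) : ((X ^ 2 + 1 : R[X]) ^ k).coeff 0 = 1 := by
  simp [coeff_zero_eq_eval_zero]

theorem coeff_zero_recipLift (m : ℕ) (f : R[X]) : (recipLift m f).coeff 0 = f.coeff m := by
  cases m with
  | zero => simp [recipLift]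
  | succ m =>
    rw [recipLift_succ, coeff_add, coeff_X_mul_zero, coeff_C_mul, coeff_zero_X_sq_add_one_pow,
      mul_one, add_zero]

theorem coeff_eq_of_recipLift_eq {m : ℕ} {f g : R[X]} (h : recipLift m f = recipLift m g) :
    ∀ k ≤ m, f.coeff k = g.coeff k := by
  have hlead : f.coeff m = g.coeff m := by
    rw [← coeff_zero_recipLift, h, coeff_zero_recipLift]
  induction m with
  | zero => exact fun k hk => Nat.le_zero.1 hk ▸ hlead
  | succ m ih =>
    have hm : recipLift m f = recipLift m g := by
      rw [recipLift_succ, recipLift_succ, hlead, add_right_inj] at h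
      exact isRegular_X.left h
    intro k hk
    rcases Nat.le_succ_iff.1 hk with hk | rfl
    · exact ih hm (by rw [← coeff_zero_recipLift, hm, coeff_zero_recipLift]) k hk
    · exact hlead

theorem recipLift_inj {m : ℕ} {f g : R[X]} (hf : f.natDegree ≤ m) (hg : g.natDegree ≤ m) :
    recipLift m f = recipLift m g ↔ f = g := by
  refine ⟨fun h => ?_, fun h => h ▸ rfl⟩
  rw [ext_iff_natDegree_le hf hg]
  exact coeff_eq_of_recipLift_eq h

theorem natDegree_X_sq_add_one_pow_le (k : ℕ) : ((X ^ 2 + 1 : R[X]) ^ k).natDegree ≤ 2 * k := by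
  rw [mul_comm]
  exact natDegree_pow_le_of_le k (by compute_degree)

theorem reflect_X_sq_add_one_pow (k : ℕ) :
    reflect (2 * k) ((X ^ 2 + 1 : R[X]) ^ k) = (X ^ 2 + 1) ^ k := by
  have hbase : reflect 2 (X ^ 2 + 1 : R[X]) = X ^ 2 + 1 := by
    rw [reflect_add, reflect_monomial, revAt_le le_rfl, reflect_one, Nat.sub_self, pow_zero,
      add_comm]
  induction k with
  | zero => simp
  | succ k ih =>
    rw [pow_succ, mul_add, mul_one, reflect_mul _ _ (natDegree_X_sq_add_one_pow_le k)
      (by compute_degree), ih, hbase]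

theorem natDegree_recipLift_le (m : ℕ) (f : R[X]) : (recipLift m f).natDegree ≤ 2 * m := by
  refine natDegree_sum_le_of_forall_le _ _ fun k hk => natDegree_mul_le.trans ?_
  have hk : k ≤ m := Finset.mem_range_succ_iff.1 hk
  have hX := natDegree_X_pow_le (R := R) (m - k)
  have hC := (natDegree_C_mul_le (f.coeff k) ((X ^ 2 + 1) ^ k)).trans
    (natDegree_X_sq_add_one_pow_le k)
  omega

theorem reflect_recipLift (m : ℕ) (f : R[X]) :
    reflect (2 * m) (recipLift m f) = recipLift m f := by
  induction m with
  | zero => simp [recipLift]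
  | succ m ih =>
    have hX : reflect 2 (X : R[X]) = X := by
      simpa [revAt_le one_le_two] using reflect_monomial (R := R) 2 1
    have hmul : reflect (2 * (m + 1)) (X * recipLift m f) = X * recipLift m f := by
      rw [mul_add, mul_one, add_comm, reflect_mul _ _ (natDegree_X_le.trans one_le_two)
        (natDegree_recipLift_le m f), ih, hX]
    rw [recipLift_succ, reflect_add, reflect_C_mul, reflect_X_sq_add_one_pow, hmul]

theorem coeff_sub_of_reflect_eq {n : ℕ} {p : R[X]} (hr : reflect n p = p) {i : ℕ} (hi : i ≤ n) :
    p.coeff (n - i) = p.coeff i := by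
  rw [← revAt_le hi, ← coeff_reflect, hr]

theorem natDegree_divX_le_of_reflect_eq {n : ℕ} {p : R[X]} (hp : p.natDegree ≤ n + 2)
    (hr : reflect (n + 2) p = p) (h0 : p.coeff 0 = 0) : p.divX.natDegree ≤ n := by
  rw [natDegree_le_iff_coeff_eq_zero]
  intro i hi
  rw [coeff_divX]
  rcases Nat.lt_or_eq_of_le (Nat.succ_le_of_lt hi) with hi | rfl
  · exact coeff_eq_zero_of_natDegree_lt (by omega)
  · exact (coeff_sub_of_reflect_eq hr (Nat.zero_le _)).trans h0

theorem reflect_divX_of_reflect_eq {n : ℕ} {p : R[X]} (hr : reflect (n + 2) p = p) :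
    reflect n p.divX = p.divX := by
  ext i
  rw [coeff_reflect]
  rcases le_or_gt i n with hi | hi
  · rw [revAt_le hi, coeff_divX, coeff_divX,
      ← coeff_sub_of_reflect_eq hr (by omega : i + 1 ≤ n + 2)]
    congr 1
    omega
  · rw [revAt_eq_self_of_lt hi]

theorem exists_recipLift_eq {m : ℕ} {p : R[X]} (hp : p.natDegree ≤ 2 * m)
    (hr : reflect (2 * m) p = p) : ∃ f : R[X], f.natDegree ≤ m ∧ recipLift m f = p := by
  induction m generalizing p with
  | zero =>
    obtain ⟨c, rfl⟩ := natDegree_eq_zero.1 (Nat.le_zero.1 hp)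
    exact ⟨C c, (natDegree_C c).le, by simp [recipLift]⟩
  | succ m ih =>
    set c := p.coeff 0
    set q := p - C c * (X ^ 2 + 1) ^ (m + 1) with hq
    have hq0 : q.coeff 0 = 0 := by
      rw [hq, coeff_sub, coeff_C_mul, coeff_zero_X_sq_add_one_pow, mul_one, sub_self]
    have hqr : reflect (2 * m + 2) q = q := by
      rw [hq, reflect_sub, ← mul_add_one, hr, reflect_C_mul, reflect_X_sq_add_one_pow]
    have hqd : q.natDegree ≤ 2 * m + 2 := natDegree_sub_le_of_le hp
      ((natDegree_C_mul_le _ _).trans (natDegree_X_sq_add_one_pow_le _)) |>.trans (max_self _).le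
    obtain ⟨g, hg, hgq⟩ := ih (natDegree_divX_le_of_reflect_eq hqd hqr hq0)
      (reflect_divX_of_reflect_eq hqr)
    refine ⟨g + C c * X ^ (m + 1), ?_, ?_⟩
    · exact natDegree_add_le_of_le (hg.trans (Nat.le_succ m)) (natDegree_C_mul_X_pow_le _ _)
        |>.trans (max_self _).le
    · have hlow : recipLift m (g + C c * X ^ (m + 1)) = recipLift m g := by
        refine Finset.sum_congr rfl fun k hk => ?_
        simp [coeff_X_pow, (Finset.mem_range.1 hk).ne]
      have hlead : (g + C c * X ^ (m + 1)).coeff (m + 1) = c := by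
        simp [coeff_eq_zero_of_natDegree_lt (Nat.lt_succ_of_le hg)]
      have hqX : X * q.divX = q := by
        simpa only [hq0, map_zero, add_zero, mul_comm X] using divX_mul_X_add q
      rw [recipLift_succ, hlow, hlead, hgq, hqX, hq, add_sub_cancel]

end RecipLift

section Rho

theorem rho_eq_of_toLaurent {f p : ℂ[X]} {n : ℕ}
    (h : p.toLaurent =
      aeval (LaurentPolynomial.T 1 + LaurentPolynomial.T (-1)) f * LaurentPolynomial.T n) :
    rho f = p.mahlerMeasure :=
  laurentMahlerMeasure_eq h

theorem rho_eq_mahlerMeasure_recipLift {f : ℂ[X]} {m : ℕ} (hf : f.natDegree ≤ m) :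
    rho f = (recipLift m f).mahlerMeasure :=
  rho_eq_of_toLaurent (toLaurent_recipLift hf)

theorem rho_mul (f g : ℂ[X]) : rho (f * g) = rho f * rho g := by
  have h : (recipLift f.natDegree f * recipLift g.natDegree g).toLaurent =
      aeval (LaurentPolynomial.T 1 + LaurentPolynomial.T (-1)) (f * g) *
        LaurentPolynomial.T (f.natDegree + g.natDegree : ℕ) := by
    rw [map_mul, toLaurent_recipLift le_rfl, toLaurent_recipLift le_rfl, map_mul, Nat.cast_add,
      LaurentPolynomial.T_add]
    ring
  rw [rho_eq_of_toLaurent h, mahlerMeasure_mul, ← rho_eq_mahlerMeasure_recipLift le_rfl,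
    ← rho_eq_mahlerMeasure_recipLift le_rfl]

theorem rho_C (c : ℂ) : rho (C c) = ‖c‖ := by
  simp [rho_eq_mahlerMeasure_recipLift (natDegree_C c).le, recipLift]

theorem rho_pos {f : ℂ[X]} (hf : f ≠ 0) : 0 < rho f := by
  rw [rho_eq_mahlerMeasure_recipLift le_rfl]
  refine mahlerMeasure_pos_of_ne_zero fun h => hf ?_
  rw [← recipLift_inj le_rfl (natDegree_zero.trans_le (Nat.zero_le _)), h, recipLift_zero]

theorem rho_joukowski {α : ℂ} (hα : ‖α‖ ≤ 1) : rho (C α * X - C (1 + α ^ 2)) = 1 := by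
  have hlift : recipLift 1 (C α * X - C (1 + α ^ 2)) = (C α * X + C (-1)) * (X - C α) := by
    rw [sub_eq_add_neg, ← C_neg, recipLift_one_C_mul_X_add_C, C_neg, C_add, C_pow, C_neg, C_1]
    ring
  have hleft : (C α * X + C (-1)).mahlerMeasure = 1 := by
    rcases eq_or_ne α 0 with rfl | h0
    · rw [C_0, zero_mul, zero_add, mahlerMeasure_const, norm_neg, norm_one]
    · rw [mahlerMeasure_C_mul_X_add_C h0]
      simpa using hα
  have hdeg : (C α * X - C (1 + α ^ 2)).natDegree ≤ 1 := by compute_degree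
  rw [rho_eq_mahlerMeasure_recipLift hdeg, hlift, mahlerMeasure_mul, hleft, one_mul,
    mahlerMeasure_X_sub_C, max_eq_left hα]

/-- The reciprocal Mahler measure of a real polynomial. -/
def realRho (p : ℝ[X]) : ℝ := rho (p.map Complex.ofRealHom)

theorem realRho_mul (p q : ℝ[X]) : realRho (p * q) = realRho p * realRho q := by
  rw [realRho, Polynomial.map_mul, rho_mul, realRho, realRho]

theorem realRho_C (c : ℝ) : realRho (C c) = |c| := by
  rw [realRho, map_C, rho_C, Complex.ofRealHom_eq_coe, Complex.norm_real, Real.norm_eq_abs]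

theorem realRho_pos {p : ℝ[X]} (hp : p ≠ 0) : 0 < realRho p :=
  rho_pos ((Polynomial.map_ne_zero_iff Complex.ofRealHom.injective).2 hp)

theorem ne_zero_of_realRho_eq_one {p : ℝ[X]} (hp : realRho p = 1) : p ≠ 0 := by
  rintro rfl
  rw [← C_0, realRho_C, abs_zero] at hp
  exact zero_ne_one hp

end Rho

section CoeffPoly

variable {R S : Type*} [CommSemiring R] [CommSemiring S] {m n N : ℕ}

/-- `ofCoeffs` over an arbitrary ring: the polynomial with coefficient vector `a`, leading term
first. -/
def coeffPoly (a : Fin (N + 1) → R) : R[X] :=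
  ∑ i : Fin (N + 1), C (a i) * X ^ (N - (i : ℕ))

/-- The inverse of `coeffPoly` on polynomials of degree at most `N`. -/
def coeffVec (N : ℕ) (p : R[X]) : Fin (N + 1) → R :=
  fun i => p.coeff (N - (i : ℕ))

theorem coeffVec_coeffPoly (a : Fin (N + 1) → R) : coeffVec N (coeffPoly a) = a := by
  funext i
  have hi (j : Fin (N + 1)) : N - (i : ℕ) = N - j ↔ i = j := by omega
  simp [coeffVec, coeffPoly, coeff_X_pow, hi]

theorem coeffPoly_injective : Function.Injective (coeffPoly : (Fin (N + 1) → R) → R[X]) :=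
  Function.LeftInverse.injective coeffVec_coeffPoly

theorem coeffPoly_coeffVec {p : R[X]} (hp : p.natDegree ≤ N) : coeffPoly (coeffVec N p) = p := by
  conv_rhs => rw [p.as_sum_range_C_mul_X_pow' (Nat.lt_succ_of_le hp), ← Finset.sum_range_reflect,
    Finset.sum_range]
  rfl

theorem natDegree_coeffPoly_le (a : Fin (N + 1) → R) : (coeffPoly a).natDegree ≤ N :=
  natDegree_sum_le_of_forall_le _ _ fun _ _ => (natDegree_C_mul_X_pow_le _ _).trans (Nat.sub_le _ _)

theorem coeffPoly_map (φ : R →+* S) (a : Fin (N + 1) → R) :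
    (coeffPoly a).map φ = coeffPoly fun i => φ (a i) := by
  simp [coeffPoly, Polynomial.map_sum]

theorem coeffPoly_smul (c : R) (a : Fin (N + 1) → R) : coeffPoly (c • a) = C c * coeffPoly a := by
  simp [coeffPoly, Finset.mul_sum, mul_assoc]

theorem coeffPoly_fin_one (a : Fin 1 → R) : coeffPoly a = C (a 0) := by
  simp [coeffPoly]

theorem coeffPoly_fin_two (a : Fin 2 → R) : coeffPoly a = C (a 0) * X + C (a 1) := by
  simp [coeffPoly, Fin.sum_univ_succ]

theorem coeffPoly_fin_three (a : Fin 3 → R) :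
    coeffPoly a = C (a 0) * X ^ 2 + C (a 1) * X + C (a 2) := by
  simp [coeffPoly, Fin.sum_univ_succ, add_assoc]

/-- The coefficient vector of the product of two polynomials given by coefficient vectors. -/
def mulCoeffs (a : Fin (m + 1) → R) (b : Fin (n + 1) → R) : Fin (m + n + 1) → R :=
  coeffVec (m + n) (coeffPoly a * coeffPoly b)

theorem coeffPoly_mulCoeffs (a : Fin (m + 1) → R) (b : Fin (n + 1) → R) :
    coeffPoly (mulCoeffs a b) = coeffPoly a * coeffPoly b :=
  coeffPoly_coeffVec <|
    natDegree_mul_le_of_le (natDegree_coeffPoly_le a) (natDegree_coeffPoly_le b)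

theorem contDiff_coeff_coeffPoly (k : WithTop ℕ∞) (j : ℕ) :
    ContDiff ℝ k fun a : Fin (N + 1) → ℝ => (coeffPoly a).coeff j := by
  simp only [coeffPoly, finsetSum_coeff, coeff_C_mul]
  fun_prop

theorem contDiff_mulCoeffs (k : WithTop ℕ∞) (m n : ℕ) : ContDiff ℝ k
    fun x : (Fin (m + 1) → ℝ) × (Fin (n + 1) → ℝ) => mulCoeffs x.1 x.2 := by
  refine contDiff_pi.2 fun i => ?_
  simp only [mulCoeffs, coeffVec, coeff_mul]
  exact ContDiff.sum fun x _ => ((contDiff_coeff_coeffPoly k x.1).comp contDiff_fst).mul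
    ((contDiff_coeff_coeffPoly k x.2).comp contDiff_snd)

end CoeffPoly

section RhoSphere

/-- The coefficient vectors of the real polynomials of degree at most `N` with reciprocal Mahler
measure one, a set that contains the boundary of the real unit star body. -/
def rhoSphere (N : ℕ) : Set (Fin (N + 1) → ℝ) := {a | realRho (coeffPoly a) = 1}

variable {N m n : ℕ}

theorem realRho_coeffPoly_smul (t : ℝ) (a : Fin (N + 1) → ℝ) :
    realRho (coeffPoly (t • a)) = |t| * realRho (coeffPoly a) := by
  rw [coeffPoly_smul, realRho_mul, realRho_C]

theorem smul_mem_rhoSphere_iff {a : Fin (N + 1) → ℝ} (ha : a ∈ rhoSphere N) {s : ℝ} :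
    s • a ∈ rhoSphere N ↔ s ∈ Metric.sphere 0 1 := by
  change realRho _ = 1 ↔ _
  rw [realRho_coeffPoly_smul, show realRho (coeffPoly a) = 1 from ha, mul_one,
    mem_sphere_zero_iff_norm, Real.norm_eq_abs]

theorem mem_image_smul_of_eq_smul {ι : Type*} {v : ι → Fin (N + 1) → ℝ} {A : Set ι}
    {a : Fin (N + 1) → ℝ} (ha : a ∈ rhoSphere N) {s : ℝ} {x : ι} (hx : x ∈ A)
    (hv : v x ∈ rhoSphere N) (h : s • v x = a) :
    a ∈ (fun y : ℝ × ι => y.1 • v y.2) '' (Metric.sphere 0 1 ×ˢ A) :=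
  ⟨(s, x), ⟨(smul_mem_rhoSphere_iff hv).1 (h ▸ ha), hx⟩, h⟩

theorem image_smul_subset_rhoSphere {ι : Type*} {v : ι → Fin (N + 1) → ℝ} {A : Set ι}
    (hv : ∀ x ∈ A, v x ∈ rhoSphere N) :
    (fun y : ℝ × ι => y.1 • v y.2) '' (Metric.sphere 0 1 ×ˢ A) ⊆ rhoSphere N := by
  rintro _ ⟨⟨s, x⟩, ⟨hs, hx⟩, rfl⟩
  exact (smul_mem_rhoSphere_iff (hv x hx)).2 hs

theorem mem_image_mulCoeffs {c : Fin (m + n + 1) → ℝ} (hc : c ∈ rhoSphere (m + n)) {p q : ℝ[X]}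
    (hp : p.natDegree ≤ m) (hq : q.natDegree ≤ n) (h : coeffPoly c = p * q) :
    c ∈ (fun x : (Fin (m + 1) → ℝ) × (Fin (n + 1) → ℝ) => mulCoeffs x.1 x.2) ''
      (rhoSphere m ×ˢ rhoSphere n) := by
  have hpq : realRho p * realRho q = 1 := by rw [← realRho_mul, ← h]; exact hc
  have hp0 : 0 < realRho p := realRho_pos <|
    left_ne_zero_of_mul (h ▸ ne_zero_of_realRho_eq_one hc)
  refine ⟨(coeffVec m (C (realRho p)⁻¹ * p), coeffVec n (C (realRho p) * q)), ⟨?_, ?_⟩, ?_⟩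
  · change realRho _ = 1
    rw [coeffPoly_coeffVec ((natDegree_C_mul_le _ _).trans hp), realRho_mul, realRho_C, abs_inv,
      abs_of_pos hp0, inv_mul_cancel₀ hp0.ne']
  · change realRho _ = 1
    rw [coeffPoly_coeffVec ((natDegree_C_mul_le _ _).trans hq), realRho_mul, realRho_C,
      abs_of_pos hp0, hpq]
  · refine coeffPoly_injective ?_
    rw [coeffPoly_mulCoeffs, coeffPoly_coeffVec ((natDegree_C_mul_le _ _).trans hp),
      coeffPoly_coeffVec ((natDegree_C_mul_le _ _).trans hq), mul_mul_mul_comm, ← C_mul,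
      inv_mul_cancel₀ hp0.ne', C_1, one_mul, h]

theorem image_mulCoeffs_subset_rhoSphere :
    (fun x : (Fin (m + 1) → ℝ) × (Fin (n + 1) → ℝ) => mulCoeffs x.1 x.2) ''
      (rhoSphere m ×ˢ rhoSphere n) ⊆ rhoSphere (m + n) := by
  rintro _ ⟨⟨a, b⟩, ⟨ha : realRho _ = 1, hb : realRho _ = 1⟩, rfl⟩
  change realRho _ = 1
  rw [coeffPoly_mulCoeffs, realRho_mul, ha, hb, one_mul]

theorem hasCover_sphere_zero_one : HasCover 0 (Metric.sphere (0 : ℝ) 1) := by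
  have h : Metric.sphere (0 : ℝ) 1 = {1, -1} := by
    ext s
    rw [mem_sphere_zero_iff_norm, Real.norm_eq_abs, abs_eq zero_le_one]
    rfl
  rw [h]
  exact HasCover.of_finite (Set.toFinite _)

theorem hasCover_rhoSphere_zero : HasCover 0 (rhoSphere 0) := by
  have h : rhoSphere 0 = (fun s _ => s) '' Metric.sphere (0 : ℝ) 1 := by
    ext a
    change realRho _ = 1 ↔ _
    rw [coeffPoly_fin_one, realRho_C, ← Real.norm_eq_abs, ← mem_sphere_zero_iff_norm]
    refine ⟨fun ha => ⟨a 0, ha, funext fun i => congrArg a (Fin.fin_one_eq_zero i).symm⟩, ?_⟩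
    rintro ⟨s, hs, rfl⟩
    exact hs
  rw [h]
  exact hasCover_sphere_zero_one.image (by fun_prop)

theorem linear_mem_rhoSphere {u : ℝ} (hu : |u| ≤ 1) : ![u, -(1 + u ^ 2)] ∈ rhoSphere 1 := by
  change realRho _ = 1
  have hα : ‖(u : ℂ)‖ ≤ 1 := by rwa [Complex.norm_real]
  rw [realRho, coeffPoly_fin_two]
  simpa [sub_eq_add_neg] using rho_joukowski hα

theorem monic_linear_mem_rhoSphere {c : ℝ} (hc : |c| ≤ 1) : ![1, -(2 * c)] ∈ rhoSphere 1 := by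
  change realRho _ = 1
  set α := Complex.exp (Real.arccos c * Complex.I) with hα
  have hnorm : ‖α‖ = 1 := Complex.norm_exp_ofReal_mul_I _
  have hsq : 1 + α ^ 2 = α * ((2 * c : ℝ) : ℂ) := by
    have hre : α.re = c := by
      rw [hα, Complex.exp_ofReal_mul_I_re, Real.cos_arccos (abs_le.1 hc).1 (abs_le.1 hc).2]
    have hconj : α * (starRingEnd ℂ) α = 1 := by
      rw [Complex.mul_conj', hnorm, Complex.ofReal_one, one_pow]
    rw [← hre, ← Complex.add_conj, mul_add, hconj, sq, add_comm]
  have h := rho_joukowski hnorm.le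
  rw [hsq, C_mul, ← mul_sub, rho_mul, rho_C, hnorm, one_mul] at h
  rw [realRho, coeffPoly_fin_two]
  simpa [sub_eq_add_neg] using h

theorem exists_abs_le_one_mul_one_add_sq_eq {a b : ℝ} (h : 2 * |a| ≤ |b|) :
    ∃ u : ℝ, |u| ≤ 1 ∧ a * (1 + u ^ 2) = -(b * u) := by
  obtain ⟨hleft, hright⟩ := abs_le.1 <| show |2 * a| ≤ |b| by rwa [abs_mul, abs_two]
  have h0 : (0 : ℝ) ∈ Set.uIcc (a * (1 + (-1) ^ 2) + b * (-1)) (a * (1 + 1 ^ 2) + b * 1) := by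
    rw [Set.mem_uIcc]
    rcases le_total 0 b with hb | hb
    · rw [abs_of_nonneg hb] at hleft hright
      exact Or.inl ⟨by linarith, by linarith⟩
    · rw [abs_of_nonpos hb] at hleft hright
      exact Or.inr ⟨by linarith, by linarith⟩
  obtain ⟨u, hu, hu0⟩ := intermediate_value_uIcc (f := fun u : ℝ => a * (1 + u ^ 2) + b * u)
    (by fun_prop) h0
  rw [Set.uIcc_of_le (by norm_num)] at hu
  exact ⟨u, abs_le.2 hu, eq_neg_of_add_eq_zero_left hu0⟩

theorem rhoSphere_one : rhoSphere 1 =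
    (fun x : ℝ × ℝ => x.1 • ![x.2, -(1 + x.2 ^ 2)]) '' (Metric.sphere 0 1 ×ˢ Set.Icc (-1) 1) ∪
    (fun x : ℝ × ℝ => x.1 • ![1, -(2 * x.2)]) '' (Metric.sphere 0 1 ×ˢ Set.Icc (-1) 1) := by
  refine Set.Subset.antisymm (fun a ha => ?_) <| Set.union_subset
    (image_smul_subset_rhoSphere fun u hu => linear_mem_rhoSphere (abs_le.2 hu))
    (image_smul_subset_rhoSphere fun c hc => monic_linear_mem_rhoSphere (abs_le.2 hc))
  rcases le_total (2 * |a 0|) |a 1| with h | h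
  · obtain ⟨u, hu, hau⟩ := exists_abs_le_one_mul_one_add_sq_eq h
    refine Or.inl <| mem_image_smul_of_eq_smul (s := -(a 1 / (1 + u ^ 2)))
      (v := fun u : ℝ => ![u, -(1 + u ^ 2)]) ha (abs_le.1 hu) (linear_mem_rhoSphere hu) ?_
    refine funext (Fin.forall_fin_two.2 ⟨?_, ?_⟩)
    · change -(a 1 / (1 + u ^ 2)) * u = a 0
      field_simp
      linarith
    · change -(a 1 / (1 + u ^ 2)) * -(1 + u ^ 2) = a 1
      field_simp
  · have ha0 : a 0 ≠ 0 := fun h0 => ne_zero_of_realRho_eq_one ha <| by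
      have h1 : a 1 = 0 := by simpa [h0] using h
      rw [coeffPoly_fin_two, h0, h1, C_0, zero_mul, zero_add]
    have hc : |-(a 1 / (2 * a 0))| ≤ 1 := by
      rw [abs_neg, abs_div, abs_mul, abs_two]
      exact div_le_one_of_le₀ h (by positivity)
    refine Or.inr <| mem_image_smul_of_eq_smul (s := a 0)
      (v := fun c : ℝ => ![1, -(2 * c)]) ha (abs_le.1 hc) (monic_linear_mem_rhoSphere hc) ?_
    refine funext (Fin.forall_fin_two.2 ⟨mul_one _, ?_⟩)
    change a 0 * -(2 * -(a 1 / (2 * a 0))) = a 1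
    field_simp

theorem HasCover.image_smul {E F : Type*} [NormedAddCommGroup E] [NormedSpace ℝ E]
    [NormedAddCommGroup F] [NormedSpace ℝ F] {k : ℕ} {A : Set E} (hA : HasCover k A) {v : E → F}
    (hv : ContDiff ℝ 1 v) :
    HasCover k ((fun y : ℝ × E => y.1 • v y.2) '' (Metric.sphere 0 1 ×ˢ A)) := by
  have h := hasCover_sphere_zero_one.prod hA
  rw [zero_add] at h
  exact h.image (by fun_prop)

theorem hasCover_rhoSphere_one : HasCover 1 (rhoSphere 1) := by
  have hlinear : ContDiff ℝ 1 fun u : ℝ => ![u, -(1 + u ^ 2)] :=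
    contDiff_pi.2 <| Fin.forall_fin_two.2
      ⟨contDiff_id, show ContDiff ℝ 1 fun u : ℝ => -(1 + u ^ 2) by fun_prop⟩
  have hmonic : ContDiff ℝ 1 fun c : ℝ => ![1, -(2 * c)] :=
    contDiff_pi.2 <| Fin.forall_fin_two.2
      ⟨contDiff_const, show ContDiff ℝ 1 fun c : ℝ => -(2 * c) by fun_prop⟩
  rw [rhoSphere_one]
  exact (hasCover_Icc.image_smul hlinear).union (hasCover_Icc.image_smul hmonic)

theorem hasCover_closedBall_complex : HasCover 2 (Metric.closedBall (0 : ℂ) 1) := by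
  let polar (x : ℝ × ℝ) : ℂ := x.1 * Complex.exp ((Real.pi * x.2 : ℝ) * Complex.I)
  have hpolar : ContDiff ℝ 1 polar := by
    have hreal {f : ℝ × ℝ → ℝ} (hf : ContDiff ℝ 1 f) : ContDiff ℝ 1 fun x => (f x : ℂ) :=
      Complex.ofRealCLM.contDiff.comp hf
    exact (hreal contDiff_fst).mul <|
      ((hreal (contDiff_const.mul contDiff_snd)).mul contDiff_const).cexp
  suffices h : Metric.closedBall (0 : ℂ) 1 = polar '' (Set.Icc (-1) 1 ×ˢ Set.Icc (-1) 1) by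
    rw [h]
    exact (hasCover_Icc.prod hasCover_Icc).image hpolar
  ext α
  rw [mem_closedBall_zero_iff]
  constructor
  · intro hα
    refine ⟨(‖α‖, α.arg / Real.pi), ⟨?_, abs_le.1 ?_⟩, ?_⟩
    · exact ⟨by linarith [norm_nonneg α], hα⟩
    · rw [abs_div, abs_of_pos Real.pi_pos]
      exact div_le_one_of_le₀ α.abs_arg_le_pi Real.pi_pos.le
    · change (‖α‖ : ℂ) * Complex.exp ((Real.pi * (α.arg / Real.pi) : ℝ) * Complex.I) = α
      rw [mul_div_cancel₀ _ Real.pi_ne_zero, Complex.norm_mul_exp_arg_mul_I]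
  · rintro ⟨x, ⟨hx, -⟩, rfl⟩
    rw [norm_mul, Complex.norm_exp_ofReal_mul_I, mul_one, Complex.norm_real]
    exact abs_le.2 hx

/-- The coefficient vector of `(α x - (1 + α ^ 2)) (ᾱ x - (1 + ᾱ ^ 2))`, whose lift has the roots
`α`, `α⁻¹` and their conjugates. -/
def joukowskiQuadratic (α : ℂ) : Fin 3 → ℝ :=
  ![‖α‖ ^ 2, -(2 * ((starRingEnd ℂ) α * (1 + α ^ 2)).re), ‖1 + α ^ 2‖ ^ 2]

theorem coeffPoly_joukowskiQuadratic (α : ℂ) :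
    coeffPoly (N := 2) (joukowskiQuadratic α) = C (‖α‖ ^ 2) * X ^ 2 -
      C (2 * ((starRingEnd ℂ) α * (1 + α ^ 2)).re) * X + C (‖1 + α ^ 2‖ ^ 2) := by
  rw [coeffPoly_fin_three]
  simp [joukowskiQuadratic, sub_eq_add_neg]

theorem map_coeffPoly_joukowskiQuadratic (α : ℂ) :
    (coeffPoly (N := 2) (joukowskiQuadratic α)).map Complex.ofRealHom =
      (C α * X - C (1 + α ^ 2)) *
        (C ((starRingEnd ℂ) α) * X - C (1 + (starRingEnd ℂ) α ^ 2)) := by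
  have h1 : ((‖α‖ ^ 2 : ℝ) : ℂ) = α * (starRingEnd ℂ) α := by
    rw [Complex.mul_conj', Complex.ofReal_pow]
  have h2 : ((2 * ((starRingEnd ℂ) α * (1 + α ^ 2)).re : ℝ) : ℂ) =
      (starRingEnd ℂ) α * (1 + α ^ 2) + α * (1 + (starRingEnd ℂ) α ^ 2) := by
    rw [← Complex.add_conj]
    simp
  have h3 : ((‖1 + α ^ 2‖ ^ 2 : ℝ) : ℂ) = (1 + α ^ 2) * (1 + (starRingEnd ℂ) α ^ 2) := by
    rw [Complex.ofReal_pow, ← Complex.mul_conj']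
    simp
  rw [coeffPoly_joukowskiQuadratic, Polynomial.map_add, Polynomial.map_sub, Polynomial.map_mul,
    Polynomial.map_mul, Polynomial.map_pow, map_C, map_C, map_C, map_X, Complex.ofRealHom_eq_coe,
    Complex.ofRealHom_eq_coe, Complex.ofRealHom_eq_coe, h1, h2, h3]
  simp only [C_mul, C_add]
  ring

theorem joukowskiQuadratic_mem_rhoSphere {α : ℂ} (hα : ‖α‖ ≤ 1) :
    joukowskiQuadratic α ∈ rhoSphere 2 := by
  change realRho _ = 1
  rw [realRho, map_coeffPoly_joukowskiQuadratic, rho_mul, rho_joukowski hα,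
    rho_joukowski ((RCLike.norm_conj α).trans_le hα), one_mul]

theorem exists_norm_le_one_mul_eq_one_add_sq (z : ℂ) :
    ∃ α : ℂ, α ≠ 0 ∧ ‖α‖ ≤ 1 ∧ α * z = 1 + α ^ 2 := by
  obtain ⟨α, hα⟩ := exists_quadratic_eq_zero (b := -z) (c := 1) one_ne_zero
    (IsAlgClosed.exists_eq_mul_self _)
  have h0 : α ≠ 0 := by
    rintro rfl
    simp at hα
  rcases le_total ‖α‖ 1 with h | h
  · exact ⟨α, h0, h, by linear_combination -hα⟩
  · refine ⟨α⁻¹, inv_ne_zero h0, (norm_inv α).trans_le (inv_le_one_of_one_le₀ h), ?_⟩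
    field_simp
    linear_combination -hα

theorem exists_eq_C_mul_joukowskiQuadratic {p : ℝ[X]} (hp : p.natDegree = 2) {z : ℂ}
    (hz : aeval z p = 0) (him : z.im ≠ 0) : ∃ s : ℝ, ∃ α ∈ Metric.closedBall (0 : ℂ) 1,
      p = C s * coeffPoly (N := 2) (joukowskiQuadratic α) := by
  obtain ⟨α, hα0, hα, h⟩ := exists_norm_le_one_mul_eq_one_add_sq z
  have hq : coeffPoly (N := 2) (joukowskiQuadratic α) =
      C (‖α‖ ^ 2) * (X ^ 2 - C (2 * z.re) * X + C (‖z‖ ^ 2)) := by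
    have hre : ((starRingEnd ℂ) α * (1 + α ^ 2)).re = ‖α‖ ^ 2 * z.re := by
      rw [← h, ← mul_assoc, Complex.conj_mul', ← Complex.ofReal_pow, Complex.re_ofReal_mul]
    rw [coeffPoly_joukowskiQuadratic, hre, ← h, norm_mul, mul_pow, mul_left_comm]
    simp only [C_mul]
    ring
  have hmonic : (X ^ 2 - C (2 * z.re) * X + C (‖z‖ ^ 2) : ℝ[X]).Monic := by monicity!
  have hdeg : (X ^ 2 - C (2 * z.re) * X + C (‖z‖ ^ 2) : ℝ[X]).natDegree = 2 := by
    compute_degree!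
  refine ⟨p.leadingCoeff / ‖α‖ ^ 2, α, mem_closedBall_zero_iff.2 hα, ?_⟩
  rw [hq, ← mul_assoc, ← C_mul, div_mul_cancel₀ _ (by simpa using hα0)]
  exact eq_leadingCoeff_mul_of_monic_of_dvd_of_natDegree_le hmonic
    (p.quadratic_dvd_of_aeval_eq_zero_im_ne_zero hz him) (hp.trans hdeg.symm).le

theorem exists_linear_mul_linear_or_eq_C_mul_joukowskiQuadratic {p : ℝ[X]} (hp : p.natDegree ≤ 2) :
    (∃ q r : ℝ[X], q.natDegree ≤ 1 ∧ r.natDegree ≤ 1 ∧ p = q * r) ∨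
      ∃ s : ℝ, ∃ α ∈ Metric.closedBall (0 : ℂ) 1,
        p = C s * coeffPoly (N := 2) (joukowskiQuadratic α) := by
  rcases Nat.le_succ_iff.1 hp with hp | hp
  · exact Or.inl ⟨1, p, by simp, hp, (one_mul p).symm⟩
  · obtain ⟨z, hz⟩ := IsAlgClosed.exists_aeval_eq_zero ℂ p
      (natDegree_pos_iff_degree_pos.1 (by omega)).ne'
    by_cases him : z.im = 0
    · lift z to ℝ using him
      obtain ⟨q, rfl⟩ := dvd_iff_isRoot.2 ((aeval_algebraMap_eq_zero_iff ℂ z p).1 hz)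
      refine Or.inl ⟨X - C z, q, (natDegree_X_sub_C z).le, ?_, rfl⟩
      rw [(monic_X_sub_C z).natDegree_mul' (by rintro rfl; simp at hp), natDegree_X_sub_C] at hp
      omega
    · exact Or.inr (exists_eq_C_mul_joukowskiQuadratic hp hz him)

theorem rhoSphere_two : rhoSphere 2 =
    (fun x : (Fin (1 + 1) → ℝ) × (Fin (1 + 1) → ℝ) => mulCoeffs x.1 x.2) ''
      (rhoSphere 1 ×ˢ rhoSphere 1) ∪
    (fun x : ℝ × ℂ => x.1 • joukowskiQuadratic x.2) ''
      (Metric.sphere 0 1 ×ˢ Metric.closedBall 0 1) := by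
  refine Set.Subset.antisymm (fun a ha => ?_) <| Set.union_subset
    image_mulCoeffs_subset_rhoSphere (image_smul_subset_rhoSphere fun α hα =>
      joukowskiQuadratic_mem_rhoSphere (mem_closedBall_zero_iff.1 hα))
  obtain ⟨q, r, hq, hr, h⟩ | ⟨s, α, hα, h⟩ :=
    exists_linear_mul_linear_or_eq_C_mul_joukowskiQuadratic (natDegree_coeffPoly_le a)
  · exact Or.inl (mem_image_mulCoeffs (m := 1) (n := 1) ha hq hr h)
  · refine Or.inr (mem_image_smul_of_eq_smul ha hα
      (joukowskiQuadratic_mem_rhoSphere (mem_closedBall_zero_iff.1 hα)) (s := s) ?_)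
    exact coeffPoly_injective ((coeffPoly_smul s _).trans h.symm)

theorem contDiff_joukowskiQuadratic (k : WithTop ℕ∞) : ContDiff ℝ k joukowskiQuadratic := by
  have hconj : ContDiff ℝ k (starRingEnd ℂ) := Complex.conjCLE.contDiff
  have hre : ContDiff ℝ k fun α : ℂ => ((starRingEnd ℂ) α * (1 + α ^ 2)).re :=
    Complex.reCLM.contDiff.comp (hconj.mul (by fun_prop))
  refine contDiff_pi.2 <| Fin.forall_fin_succ.2 ⟨contDiff_id.norm_sq ℝ, Fin.forall_fin_two.2
    ⟨(contDiff_const.mul hre).neg, ContDiff.norm_sq ℝ ?_⟩⟩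
  fun_prop

theorem hasCover_rhoSphere_two : HasCover 2 (rhoSphere 2) := by
  rw [rhoSphere_two]
  have h := hasCover_rhoSphere_one.prod hasCover_rhoSphere_one
  exact (h.image (contDiff_mulCoeffs 1 1 1)).union
    (hasCover_closedBall_complex.image_smul (contDiff_joukowskiQuadratic 1))

theorem exists_mul_eq_of_natDegree_le_add_two {p : ℝ[X]} {J : ℕ} (hp : p.natDegree ≤ J + 2) :
    ∃ q r : ℝ[X], q.natDegree ≤ J ∧ r.natDegree ≤ 2 ∧ p = q * r := by
  rcases lt_or_ge p.natDegree 2 with h | h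
  · exact ⟨1, p, by simp, h.le, (one_mul p).symm⟩
  · obtain ⟨n, hn⟩ := Nat.exists_eq_add_of_le' h
    have hl : p.leadingCoeff ≠ 0 := leadingCoeff_ne_zero.2 (ne_zero_of_natDegree_gt h)
    have hmonic : IsMonicOfDegree (C p.leadingCoeff⁻¹ * p) (n + 2) :=
      ⟨by rw [natDegree_C_mul (inv_ne_zero hl), hn],
        by rw [Monic, leadingCoeff_mul, leadingCoeff_C, inv_mul_cancel₀ hl]⟩
    obtain ⟨r, q, hr, hq, h⟩ := hmonic.eq_isMonicOfDegree_two_mul_isMonicOfDegree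
    refine ⟨C p.leadingCoeff * q, r, (natDegree_C_mul_le _ _).trans ?_, hr.natDegree_eq.le, ?_⟩
    · rw [hq.natDegree_eq]
      omega
    · rw [mul_assoc, mul_comm q, ← h, ← mul_assoc, ← C_mul, mul_inv_cancel₀ hl, C_1, one_mul]

theorem rhoSphere_add_two (J : ℕ) : rhoSphere (J + 2) =
    (fun x : (Fin (J + 1) → ℝ) × (Fin (2 + 1) → ℝ) => mulCoeffs x.1 x.2) ''
      (rhoSphere J ×ˢ rhoSphere 2) := by
  refine Set.Subset.antisymm (fun c hc => ?_) image_mulCoeffs_subset_rhoSphere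
  obtain ⟨q, r, hq, hr, h⟩ := exists_mul_eq_of_natDegree_le_add_two (natDegree_coeffPoly_le c)
  exact mem_image_mulCoeffs hc hq hr h

theorem hasCover_rhoSphere (J : ℕ) : HasCover J (rhoSphere J) := by
  induction J using Nat.twoStepInduction with
  | zero => exact hasCover_rhoSphere_zero
  | one => exact hasCover_rhoSphere_one
  | more J ih _ =>
    rw [rhoSphere_add_two]
    exact (ih.prod hasCover_rhoSphere_two).image (contDiff_mulCoeffs 1 J 2)

end RhoSphere

section IntegerPolynomials

theorem realUnitStarBody_rho (J : ℕ) :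
    realUnitStarBody rho J = {a | realRho (coeffPoly a) ≤ 1} := by
  ext a
  change rho (coeffPoly fun i => Complex.ofRealHom (a i)) ≤ 1 ↔ realRho (coeffPoly a) ≤ 1
  rw [← coeffPoly_map, realRho]

theorem realRho_coeffPoly_pos {N : ℕ} (a : Fin (N + 1) → ℝ) (ha : a ≠ 0) :
    0 < realRho (coeffPoly a) :=
  realRho_pos fun h => ha <| coeffPoly_injective <| h.trans (by simp [coeffPoly])

theorem isBounded_realUnitStarBody_rho (J : ℕ) :
    Bornology.IsBounded (realUnitStarBody rho J) := by
  rw [realUnitStarBody_rho]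
  exact (isCompact_sublevel_one realRho_coeffPoly_pos realRho_coeffPoly_smul
    (hasCover_rhoSphere J).1).isBounded

theorem frontier_realUnitStarBody_rho_subset (J : ℕ) :
    frontier (realUnitStarBody rho J) ⊆ rhoSphere J := by
  rw [realUnitStarBody_rho]
  exact frontier_sublevel_one_subset realRho_coeffPoly_pos realRho_coeffPoly_smul
    (hasCover_rhoSphere J).1

/-- The integer polynomials of degree at most `J` and reciprocal Mahler measure at most `t`. -/
def intPolys (J : ℕ) (t : ℝ) : Set ℤ[X] :=
  {g | g.natDegree ≤ J ∧ rho (g.map (Int.castRingHom ℂ)) ≤ t}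

theorem corner_mem_realUnitStarBody_rho_iff {J : ℕ} {t : ℝ} (ht : 0 < t) {z : Fin (J + 1) → ℤ} :
    corner t z ∈ realUnitStarBody rho J ↔ rho ((coeffPoly z).map (Int.castRingHom ℂ)) ≤ t := by
  have hz : corner t z = t⁻¹ • fun i => Int.castRingHom ℝ (z i) :=
    funext fun i => div_eq_inv_mul _ _
  rw [realUnitStarBody_rho, Set.mem_ofPred_eq, hz, realRho_coeffPoly_smul, ← coeffPoly_map, realRho,
    Polynomial.map_map, RingHom.eq_intCast' (Complex.ofRealHom.comp (Int.castRingHom ℝ)),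
    abs_of_pos (inv_pos.2 ht), inv_mul_le_one₀ ht]

theorem bijOn_coeffPoly_intPolys (J : ℕ) {t : ℝ} (ht : 0 < t) :
    Set.BijOn coeffPoly {z : Fin (J + 1) → ℤ | corner t z ∈ realUnitStarBody rho J}
      (intPolys J t) := by
  refine ⟨fun z hz => ⟨natDegree_coeffPoly_le z, (corner_mem_realUnitStarBody_rho_iff ht).1 hz⟩,
    coeffPoly_injective.injOn, fun g hg => ⟨coeffVec J g, ?_, coeffPoly_coeffVec hg.1⟩⟩
  rw [Set.mem_ofPred_eq, corner_mem_realUnitStarBody_rho_iff ht, coeffPoly_coeffVec hg.1]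
  exact hg.2

theorem isBigO_ncard_intPolys (J : ℕ) :
    (fun t : ℝ => ((intPolys J t).ncard : ℝ) -
      volume.real (realUnitStarBody rho J) * t ^ (J + 1)) =O[atTop] fun t => t ^ J := by
  refine ((hasCover_rhoSphere J).isBigO_ncard_corner_mem (isBounded_realUnitStarBody_rho J)
    (frontier_realUnitStarBody_rho_subset J)).congr' ?_ EventuallyEq.rfl
  filter_upwards [eventually_gt_atTop 0] with t ht
  rw [(bijOn_coeffPoly_intPolys J ht).ncard_eq, Fintype.card_fin]

theorem isBigO_ncard_intPolys_pow_succ (J : ℕ) :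
    (fun t : ℝ => ((intPolys J t).ncard : ℝ)) =O[atTop] fun t => t ^ (J + 1) := by
  have hpow : (fun t : ℝ => t ^ J) =O[atTop] fun t => t ^ (J + 1) :=
    (isLittleO_pow_pow_atTop_of_lt J.lt_succ_self).isBigO
  simpa only [sub_add_cancel] using ((isBigO_ncard_intPolys J).trans hpow).add
    (isBigO_const_mul_self (volume.real (realUnitStarBody rho J)) _ _)

end IntegerPolynomials

section ReciprocalPolynomials

variable {N : ℕ} {t : ℝ}

theorem finite_recipPolys (N : ℕ) (t : ℝ) : (recipPolys N t).Finite :=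
  (finite_mahlerMeasure_le N t.toNNReal).subset fun _ hf => ⟨hf.2.1, hf.2.2.trans (le_max_left _ _)⟩

/-- The reciprocal polynomials of even degree in `recipPolys N t`. -/
def evenRecipPolys (N : ℕ) (t : ℝ) : Set ℤ[X] := {f | f ∈ recipPolys N t ∧ Even f.natDegree}

theorem finite_evenRecipPolys (N : ℕ) (t : ℝ) : (evenRecipPolys N t).Finite :=
  (finite_recipPolys N t).subset fun _ hf => hf.1

theorem natDegree_recipLift_natDegree {R : Type*} [CommRing R] (g : R[X]) :
    (recipLift g.natDegree g).natDegree = 2 * g.natDegree := by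
  rcases eq_or_ne g 0 with rfl | hg
  · rw [recipLift_zero, natDegree_zero]
  refine le_antisymm (natDegree_recipLift_le _ _) (le_natDegree_of_ne_zero ?_)
  rw [← reflect_recipLift, coeff_reflect, revAt_le le_rfl, Nat.sub_self, coeff_zero_recipLift]
  exact leadingCoeff_ne_zero.2 hg

theorem isReciprocal_recipLift_natDegree (g : ℤ[X]) :
    IsReciprocal (recipLift g.natDegree g) := by
  rw [IsReciprocal, reverse, natDegree_recipLift_natDegree, reflect_recipLift]

theorem rho_map_eq_mahlerMeasure_map_recipLift (g : ℤ[X]) :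
    rho (g.map (Int.castRingHom ℂ)) =
      ((recipLift g.natDegree g).map (Int.castRingHom ℂ)).mahlerMeasure := by
  rw [rho_eq_mahlerMeasure_recipLift natDegree_map_le, recipLift_map]

theorem recipLift_natDegree_injective :
    Function.Injective fun g : ℤ[X] => recipLift g.natDegree g := by
  intro g h (hgh : recipLift g.natDegree g = recipLift h.natDegree h)
  have hdeg : g.natDegree = h.natDegree := by
    have := congrArg natDegree hgh
    simp only [natDegree_recipLift_natDegree] at this
    omega
  rw [hdeg] at hgh
  exact (recipLift_inj hdeg.le le_rfl).1 hgh

theorem IsReciprocal.exists_recipLift_natDegree_eq {f : ℤ[X]} (hf : IsReciprocal f)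
    (heven : Even f.natDegree) : ∃ g : ℤ[X], recipLift g.natDegree g = f := by
  rcases eq_or_ne f 0 with rfl | hf0
  · exact ⟨0, recipLift_zero _⟩
  obtain ⟨m, hm⟩ := heven.exists_two_nsmul
  rw [smul_eq_mul] at hm
  obtain ⟨g, hg, hgf⟩ := exists_recipLift_eq hm.le (hm ▸ hf)
  have hlead : f.coeff 0 = f.leadingCoeff := by
    rw [← coeff_zero_reverse, show f.reverse = f from hf]
  have hgm : g.natDegree = m := by
    refine le_antisymm hg (le_natDegree_of_ne_zero ?_)
    rw [← coeff_zero_recipLift, hgf, hlead]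
    exact leadingCoeff_ne_zero.2 hf0
  exact ⟨g, hgm.symm ▸ hgf⟩

theorem bijOn_recipLift (N : ℕ) (t : ℝ) :
    Set.BijOn (fun g : ℤ[X] => recipLift g.natDegree g) (intPolys (N / 2) t)
      (evenRecipPolys N t) := by
  have hdeg (g : ℤ[X]) : (recipLift g.natDegree g).natDegree ≤ N ↔ g.natDegree ≤ N / 2 := by
    rw [natDegree_recipLift_natDegree]
    omega
  refine ⟨fun g hg => ⟨⟨isReciprocal_recipLift_natDegree g, (hdeg g).2 hg.1, ?_⟩, ?_⟩,
    recipLift_natDegree_injective.injOn, ?_⟩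
  · rw [← rho_map_eq_mahlerMeasure_map_recipLift]
    exact hg.2
  · rw [natDegree_recipLift_natDegree]
    exact even_two_mul _
  · rintro f ⟨⟨hf, hN, ht⟩, heven⟩
    obtain ⟨g, rfl⟩ := hf.exists_recipLift_natDegree_eq heven
    rw [← rho_map_eq_mahlerMeasure_map_recipLift] at ht
    exact ⟨g, ⟨(hdeg g).1 hN, ht⟩, rfl⟩

theorem IsReciprocal.isRoot_neg_one {f : ℤ[X]} (hf : IsReciprocal f) (hodd : Odd f.natDegree) :
    f.IsRoot (-1) := by
  have h := eval₂_reverse_mul_pow (RingHom.id ℤ) ((-1 : ℤˣ) : ℤ) f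
  rw [show f.reverse = f from hf, invOf_units, inv_neg, inv_one, Units.val_neg, Units.val_one,
    eval₂_id, hodd.neg_one_pow] at h
  rw [IsRoot.def]
  omega

theorem X_add_one_ne_zero : (X + 1 : ℤ[X]) ≠ 0 :=
  X_add_C_ne_zero 1

theorem natDegree_X_add_one_mul {h : ℤ[X]} (hh : h ≠ 0) :
    ((X + 1) * h).natDegree = h.natDegree + 1 := by
  rw [← C_1, (monic_X_add_C 1).natDegree_mul' hh, natDegree_X_add_C, add_comm]

theorem mahlerMeasure_map_X_add_one_mul (h : ℤ[X]) :
    (((X + 1) * h).map (Int.castRingHom ℂ)).mahlerMeasure =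
      (h.map (Int.castRingHom ℂ)).mahlerMeasure := by
  have hX : (X + 1 : ℂ[X]).mahlerMeasure = 1 := by
    simpa only [C_1, norm_one, max_self] using mahlerMeasure_X_add_C 1
  rw [Polynomial.map_mul, mahlerMeasure_mul, Polynomial.map_add, map_X, Polynomial.map_one, hX,
    one_mul]

theorem isReciprocal_X_add_one_mul_iff {h : ℤ[X]} :
    IsReciprocal ((X + 1) * h) ↔ IsReciprocal h := by
  have hX : (X + 1 : ℤ[X]).reverse = X + 1 := by
    have hdeg : (X + 1 : ℤ[X]).natDegree = 1 := natDegree_X_add_C 1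
    have hreflect : reflect 1 (X : ℤ[X]) = 1 := by
      simpa only [pow_one, revAt_le le_rfl, Nat.sub_self, pow_zero] using
        reflect_monomial (R := ℤ) 1 1
    rw [reverse, hdeg, reflect_add, hreflect, reflect_one, pow_one, add_comm]
  rw [IsReciprocal, reverse_mul_of_domain, hX, IsReciprocal,
    mul_right_inj' X_add_one_ne_zero]

theorem X_add_one_mul_mem_recipPolys_iff {h : ℤ[X]} (hh : h ≠ 0) :
    (X + 1) * h ∈ recipPolys (N + 1) t ↔ h ∈ recipPolys N t := by
  simp only [recipPolys, Set.mem_ofPred_eq, isReciprocal_X_add_one_mul_iff,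
    natDegree_X_add_one_mul hh, Nat.add_le_add_iff_right, mahlerMeasure_map_X_add_one_mul]

theorem recipPolys_succ (N : ℕ) (t : ℝ) :
    recipPolys (N + 1) t =
      evenRecipPolys (N + 1) t ∪ (fun h => (X + 1) * h) '' (evenRecipPolys N t \ {0}) := by
  refine Set.Subset.antisymm (fun f hf => ?_) (Set.union_subset (fun f hf => hf.1) ?_)
  · rcases Nat.even_or_odd f.natDegree with heven | hodd
    · exact Or.inl ⟨hf, heven⟩
    · obtain ⟨h, rfl⟩ := dvd_iff_isRoot.2 (hf.1.isRoot_neg_one hodd)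
      have hh : h ≠ 0 := by
        rintro rfl
        simp at hodd
      rw [C_neg, C_1, sub_neg_eq_add] at hf hodd ⊢
      rw [natDegree_X_add_one_mul hh, Nat.odd_add_one, Nat.not_odd_iff_even] at hodd
      exact Or.inr ⟨h, ⟨⟨(X_add_one_mul_mem_recipPolys_iff hh).1 hf, hodd⟩, hh⟩, rfl⟩
  · rintro _ ⟨h, ⟨⟨hr, -⟩, hh⟩, rfl⟩
    exact (X_add_one_mul_mem_recipPolys_iff hh).2 hr

theorem disjoint_evenRecipPolys_image_X_add_one_mul (M N : ℕ) (t : ℝ) :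
    Disjoint (evenRecipPolys M t) ((fun h => (X + 1) * h) '' (evenRecipPolys N t \ {0})) := by
  refine Set.disjoint_left.2 ?_
  rintro _ ⟨-, hodd⟩ ⟨h, ⟨⟨-, heven⟩, hh⟩, rfl⟩
  rw [natDegree_X_add_one_mul hh, Nat.even_add_one] at hodd
  exact hodd heven

/-- The zero polynomial is counted in both summands on the right. -/
theorem ncard_recipPolys_succ_add_one (N : ℕ) (ht : 0 ≤ t) :
    (recipPolys (N + 1) t).ncard + 1 =
      (intPolys ((N + 1) / 2) t).ncard + (intPolys (N / 2) t).ncard := by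
  have h0 : (0 : ℤ[X]) ∈ evenRecipPolys N t :=
    ⟨⟨reverse_zero, by simp, by simpa using ht⟩, by simp⟩
  rw [recipPolys_succ, Set.ncard_union_eq (disjoint_evenRecipPolys_image_X_add_one_mul _ _ _)
      (finite_evenRecipPolys _ t) ((finite_evenRecipPolys N t).sdiff.image _),
    Set.ncard_image_of_injective _ (mul_right_injective₀ X_add_one_ne_zero), add_assoc,
    Set.ncard_sdiff_singleton_add_one h0 (finite_evenRecipPolys N t),
    (bijOn_recipLift (N + 1) t).ncard_eq, (bijOn_recipLift N t).ncard_eq]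

theorem isBigO_one_pow_atTop (k : ℕ) :
    (fun _ : ℝ => (1 : ℝ)) =O[atTop] fun t : ℝ => t ^ k := by
  refine IsBigO.of_norm_eventuallyLE ?_
  filter_upwards [eventually_ge_atTop 1] with t ht
  simpa only [norm_one] using one_le_pow₀ ht

theorem isBigO_ncard_recipPolys_of_even (J : ℕ) :
    (fun t : ℝ => ((recipPolys (2 * (J + 1)) t).ncard : ℝ) -
      volume.real (realUnitStarBody rho (J + 1)) * t ^ (J + 2)) =O[atTop] fun t => t ^ (J + 1) := by
  refine (((isBigO_ncard_intPolys (J + 1)).add (isBigO_ncard_intPolys_pow_succ J)).sub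
    (isBigO_one_pow_atTop (J + 1))).congr' ?_ EventuallyEq.rfl
  filter_upwards [eventually_ge_atTop 0] with t ht
  have h := congrArg (Nat.cast (R := ℝ)) (ncard_recipPolys_succ_add_one (2 * J + 1) ht)
  rw [show (2 * J + 1 + 1) / 2 = J + 1 by omega, show (2 * J + 1) / 2 = J by omega] at h
  push_cast at h
  rw [mul_add_one]
  linear_combination -h

theorem isBigO_ncard_recipPolys_of_odd (J : ℕ) :
    (fun t : ℝ => ((recipPolys (2 * J + 1) t).ncard : ℝ) -
      2 * volume.real (realUnitStarBody rho J) * t ^ (J + 1)) =O[atTop] fun t => t ^ J := by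
  refine (((isBigO_ncard_intPolys J).const_mul_left 2).sub (isBigO_one_pow_atTop J)).congr' ?_
    EventuallyEq.rfl
  filter_upwards [eventually_ge_atTop 0] with t ht
  have h := congrArg (Nat.cast (R := ℝ)) (ncard_recipPolys_succ_add_one (2 * J) ht)
  rw [show (2 * J + 1) / 2 = J by omega, show 2 * J / 2 = J by omega] at h
  push_cast at h
  linear_combination -h

end ReciprocalPolynomials

end ReciprocalMahler

end

theorem theorem10 (N : ℕ) (hN : 0 < N) :
    (∀ t : ℝ, (ReciprocalMahler.recipPolys N t).Finite) ∧
    (∀ J : ℕ, volume (ReciprocalMahler.realUnitStarBody ReciprocalMahler.rho J) ≠ ⊤) ∧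
    (∀ J : ℕ, N = 2 * J →
      (fun t : ℝ => ((ReciprocalMahler.recipPolys N t).ncard : ℝ) -
        (volume (ReciprocalMahler.realUnitStarBody ReciprocalMahler.rho J)).toReal * t ^ (J + 1))
        =O[atTop] fun t : ℝ => t ^ J) ∧
    (∀ J : ℕ, N = 2 * J + 1 →
      (fun t : ℝ => ((ReciprocalMahler.recipPolys N t).ncard : ℝ) -
        2 * (volume (ReciprocalMahler.realUnitStarBody ReciprocalMahler.rho J)).toReal *
          t ^ (J + 1))
        =O[atTop] fun t : ℝ => t ^ J) := by
  refine ⟨ReciprocalMahler.finite_recipPolys N,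
    fun J => (ReciprocalMahler.isBounded_realUnitStarBody_rho J).measure_lt_top.ne, ?_, ?_⟩
  · rintro J rfl
    obtain ⟨K, rfl⟩ := Nat.exists_eq_add_one.2 (pos_of_mul_pos_right hN zero_le)
    exact ReciprocalMahler.isBigO_ncard_recipPolys_of_even K
  · rintro J rfl
    exact ReciprocalMahler.isBigO_ncard_recipPolys_of_odd J
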